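/- All posets are finite. For $n\ge 0$ let $\mathcal A_n$ denote the antichain on $n$ elements, and for posets $A,B$ let $A\oplus B$ denote their ordinal sum (every element of $A$ lies below every element of $B$). For posets $P,Q$ let $c_Q(P)$ be the number of induced subposets of $P$ isomorphic to $Q$, and let $M_{n,Q}=\max\{c_Q(P): |P|=n\}$. A poset $P$ is called $Q$-optimal if $c_Q(P)=M_{|P|,Q}$. Let $\max P$ be the set of maximal elements of $P$; $P$ is called LOT (layered on top) if $P=(P\setminus\max P)\oplus\max P$. For an integer $l\ge 2$ put $Q_l=\mathcal A_1\oplus\mathcal A_l$. Theorem. Let $l\ge 2$ and let $P$ be a poset with $c_{Q_l}(P)=M_{|P|,Q_l}-1$. Then there is a poset $Q$ with $|Q|=|P|$ such that at least one of the following holds: (i) $c_{Q_l}(Q)=M_{|P|,Q_l}-1$ and $Q$ is LOT; (ii) $Q$ is $Q_l$-optimal and $|\max Q|=l$; (iii) $l=2$ and $|P|=5$. -/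

import Mathlib

universe u

/-- The antichain `𝒜ₙ` on `n` elements: `Fin n` with only the relations `x ≤ x`. -/
structure AntichainPoset (n : ℕ) where
  /-- the label of an element -/
  val : Fin n

instance AntichainPoset.instPartialOrder (n : ℕ) : PartialOrder (AntichainPoset n) where
  le x y := x = y
  le_refl _ := rfl
  le_trans _ _ _ h₁ h₂ := Eq.trans h₁ h₂
  le_antisymm _ _ h _ := h

/-- The poset `Q_l = 𝒜₁ ⊕ 𝒜_l`. Here `⊕ₗ` is Mathlib's ordinal sum: everything in the left summand
lies below everything in the right summand. -/
abbrev QPoset (l : ℕ) : Type := AntichainPoset 1 ⊕ₗ AntichainPoset l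

/-- `c_Q(P)`: the number of induced subposets of `P` that are isomorphic to `Q`. -/
noncomputable def copies (Q : Type*) [PartialOrder Q] (P : Type*) [PartialOrder P] : ℕ :=
  Set.ncard {S : Set P | Nonempty (S ≃o Q)}

/-- `M_{n,Q}`: the maximum of `c_Q(P)` over all posets `P` with `n` elements. -/
noncomputable def maxCopies (Q : Type*) [PartialOrder Q] (n : ℕ) : ℕ :=
  sSup {c : ℕ | ∃ (P : Type) (_ : PartialOrder P), Finite P ∧ Nat.card P = n ∧ copies Q P = c}

/-- The set `max P` of maximal elements of a poset. -/
def maxElements (P : Type*) [PartialOrder P] : Set P := {x | IsMax x}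

/-- `P = A ⊕ B`: the poset `P` is the ordinal sum of its induced subposets `A` and `B`. -/
def IsOrdinalSum {P : Type*} [PartialOrder P] (A B : Set P) : Prop :=
  IsCompl A B ∧ ∀ x y : P, x ≤ y ↔
    (x ∈ A ∧ y ∈ A ∧ x ≤ y) ∨ (x ∈ B ∧ y ∈ B ∧ x ≤ y) ∨ (x ∈ A ∧ y ∈ B)

/-- `P` is LOT (layered on top): `P = (P \ max P) ⊕ max P`. -/
def IsLOT (P : Type*) [PartialOrder P] : Prop :=
  IsOrdinalSum (maxElements P)ᶜ (maxElements P)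

/-- `P` is `Q`-optimal: `c_Q(P) = M_{|P|,Q}`. -/
def IsOptimal (Q : Type*) [PartialOrder Q] (P : Type*) [PartialOrder P] : Prop :=
  copies Q P = maxCopies Q (Nat.card P)

theorem copies_congr (Q : Type*) [PartialOrder Q] {P P' : Type*} [PartialOrder P]
    [PartialOrder P'] (e : P ≃o P') : copies Q P = copies Q P' := by
  have key : {S : Set P' | Nonempty (S ≃o Q)} =
      (fun S : Set P => e '' S) '' {S : Set P | Nonempty (S ≃o Q)} := by
    ext T
    constructor
    · rintro ⟨f⟩
      refine ⟨e ⁻¹' T, ⟨?_⟩, Set.image_preimage_eq T e.surjective⟩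
      refine OrderIso.trans ?_ f
      exact
        { toFun := fun x => ⟨e x.1, x.2⟩
          invFun := fun y => ⟨e.symm y.1, by simp⟩
          left_inv := fun x => by simp
          right_inv := fun y => by simp
          map_rel_iff' := by intro a b; simp }
    · rintro ⟨S, ⟨f⟩, rfl⟩
      refine ⟨OrderIso.trans ?_ f⟩
      exact
        { toFun := fun y => ⟨e.symm y.1, by
            obtain ⟨y, s, hs, rfl⟩ := y
            simpa using hs⟩
          invFun := fun x => ⟨e x.1, x.1, x.2, rfl⟩
          left_inv := fun y => by simp
          right_inv := fun x => by simp
          map_rel_iff' := by intro a b; simp }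
  unfold copies
  rw [key]
  exact (Set.ncard_image_of_injective _ e.injective.image_injective).symm

theorem bddAbove_copies (Q : Type*) [PartialOrder Q] (n : ℕ) :
    BddAbove {c : ℕ | ∃ (P : Type) (_ : PartialOrder P),
      Finite P ∧ Nat.card P = n ∧ copies Q P = c} := by
  refine ⟨2 ^ n, ?_⟩
  rintro c ⟨P, _, hP, hn, rfl⟩
  have h := Set.ncard_le_card {S : Set P | Nonempty (S ≃o Q)}
  have h2 : Nat.card (Set P) = 2 ^ n := by
    have := Fintype.ofFinite P
    classical
    rw [Nat.card_eq_fintype_card, Fintype.card_set, ← hn, Nat.card_eq_fintype_card]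
  exact h2 ▸ h

/-- The maximum defining `maxCopies Q n` is attained. -/
theorem exists_copies_eq_maxCopies (Q : Type*) [PartialOrder Q] (n : ℕ) :
    ∃ (P : Type) (_ : PartialOrder P), Finite P ∧ Nat.card P = n ∧ copies Q P = maxCopies Q n :=
  Nat.sSup_mem (s := {c : ℕ | ∃ (P : Type) (_ : PartialOrder P),
      Finite P ∧ Nat.card P = n ∧ copies Q P = c})
    ⟨_, Fin n, inferInstance, inferInstance, by simp, rfl⟩ (bddAbove_copies Q n)

theorem exists_small_orderIso (P : Type*) [PartialOrder P] [Finite P] :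
    ∃ (P' : Type) (_ : PartialOrder P'), Finite P' ∧ Nonempty (P' ≃o P) :=
  ⟨Fin (Nat.card P), PartialOrder.lift (Finite.equivFin P).symm (Finite.equivFin P).symm.injective,
    inferInstance, ⟨@RelIso.mk _ _ _ _ (Finite.equivFin P).symm Iff.rfl⟩⟩

/-- `maxCopies` bounds the number of copies in every finite poset, of any universe. -/
theorem copies_le_maxCopies (Q : Type*) [PartialOrder Q] (P : Type*) [PartialOrder P] [Finite P] :
    copies Q P ≤ maxCopies Q (Nat.card P) := by
  obtain ⟨P', _, hfin, ⟨f⟩⟩ := exists_small_orderIso P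
  exact le_csSup (bddAbove_copies Q _) ⟨P', _, hfin, Nat.card_congr f.toEquiv, copies_congr Q f⟩

open Finset

/-! A copy of `Q_l` is the same as a cherry, that is, a bottom element with an `l`-element antichain
above it, so one can count cherries of strict orders on a fixed set. The method is a symmetrization
of maximal elements in the style of Zykov. Take two classes of maximal elements with different
down-sets, `m` elements in all, and let `G i` be the count when `i` of them carry the down-set of
`a` and the rest that of `b`. The original order is `G p` with `0 < p < m`; the two ends are the
merges. `G` is convex (`two_mul_cnt_add_le`), and each merge creates new twins, so repeated merging
terminates. Once all maximal elements are twins, the order is layered.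

If the merge at `0` is optimal and layered, the convexity there is strict
(`IsRanking.strict_convex_one`). Hence optimal orders with a positive count are layered
(`layered_of_optimal`).

Now let `G p = M - 1`, and suppose all three alternatives fail. By induction no merge has value `M -
1`. Convexity then makes one end equal to `M`, and strictness at that end makes the other one `M` as
well. Both ends are layered, and as (ii) fails, `l < m`. By symmetry some element lies below `a` and
not below `b`. For `l ≥ 3` the second differences next to the two ends are at least 1 and 2, which
excludes the values `M`, `M - 1`, `M`. For `l = 2` all second differences are positive, so `G` is
`M, M-1, M-1, M`. Comparing `G 0` with `G 1` then leaves one element below `b` and one more below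
`a`, which with the three maximal elements makes five. -/

/-- `r` is a strict partial order. -/
structure StrictOrd {P : Type*} (r : P → P → Prop) : Prop where
  irrefl : ∀ a, ¬ r a a
  trans : ∀ a b c, r a b → r b c → r a c

/-- `v` has nothing above it. -/
def IsMaxFor {P : Type*} (r : P → P → Prop) (v : P) : Prop := ∀ u, ¬ r v u

/-- Every non-maximal element lies below every maximal one. -/
def Layered {P : Type*} (r : P → P → Prop) : Prop :=
  ∀ u v, IsMaxFor r v → ¬ IsMaxFor r u → r u v

/-! ### Cherries and the replacement of maximal elements by clones -/

section counting

variable {P : Type*} [Fintype P]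

open Classical in
/-- The pairs `(b, S)` where `S` is an antichain of `l` elements lying above `b`. -/
noncomputable def cherries (l : ℕ) (r : P → P → Prop) : Finset (P × Finset P) :=
  univ.filter fun q => q.2.card = l ∧ (∀ s ∈ q.2, r q.1 s) ∧ ∀ s ∈ q.2, ∀ t ∈ q.2, ¬ r s t

/-- The number of cherries. -/
noncomputable def cnt (l : ℕ) (r : P → P → Prop) : ℕ := (cherries l r).card

open Classical in
/-- The set of maximal elements. -/
noncomputable def tops (r : P → P → Prop) : Finset P := univ.filter (IsMaxFor r)

open Classical in
/-- The elements strictly below `v`. -/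
noncomputable def below (r : P → P → Prop) (v : P) : Finset P := univ.filter fun u => r u v

theorem mem_cherries {l : ℕ} {r : P → P → Prop} {q : P × Finset P} :
    q ∈ cherries l r ↔
      q.2.card = l ∧ (∀ s ∈ q.2, r q.1 s) ∧ ∀ s ∈ q.2, ∀ t ∈ q.2, ¬ r s t := by
  simp [cherries]

theorem mem_tops {r : P → P → Prop} {v : P} : v ∈ tops r ↔ IsMaxFor r v := by simp [tops]

theorem mem_below {r : P → P → Prop} {u v : P} : u ∈ below r v ↔ r u v := by simp [below]

theorem exists_top_above {r : P → P → Prop} (hr : StrictOrd r) (u : P) :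
    IsMaxFor r u ∨ ∃ v, IsMaxFor r v ∧ r u v := by
  have : IsTrans P (flip r) := ⟨fun a b c h₁ h₂ => hr.trans _ _ _ h₂ h₁⟩
  have : Std.Irrefl (flip r) := ⟨fun a => hr.irrefl a⟩
  induction u using (Finite.wellFounded_of_trans_of_irrefl (flip r)).induction with
  | _ u ih =>
    by_cases h : IsMaxFor r u
    · exact Or.inl h
    · simp only [IsMaxFor, not_forall, not_not] at h
      obtain ⟨v, hv⟩ := h
      rcases ih v hv with hv' | ⟨w, hw, hvw⟩
      · exact Or.inr ⟨v, hv', hv⟩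
      · exact Or.inr ⟨w, hw, hr.trans _ _ _ hv hvw⟩

-- Two maximal elements with the same down-set are exchanged by an automorphism of the order, namely
-- their transposition.
open Classical in
theorem card_filter_swap {l : ℕ} {r : P → P → Prop} {x y : P} (hx : IsMaxFor r x) (hy : IsMaxFor r y)
    (h : ∀ u, r u x ↔ r u y) :
    ((cherries l r).filter fun q => x ∈ q.2 ∧ y ∉ q.2).card =
      ((cherries l r).filter fun q => x ∉ q.2 ∧ y ∈ q.2).card := by
  have hs : ∀ u v, r (Equiv.swap x y u) (Equiv.swap x y v) ↔ r u v := by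
    have h1 : ∀ u v, r u (Equiv.swap x y v) ↔ r u v := by
      intro u v
      rcases eq_or_ne v x with rfl | hvx
      · simp [h]
      rcases eq_or_ne v y with rfl | hvy
      · simp [h]
      rw [Equiv.swap_apply_of_ne_of_ne hvx hvy]
    intro u v
    rw [h1]
    rcases eq_or_ne u x with rfl | hvx
    · simp [hx v, hy v]
    rcases eq_or_ne u y with rfl | hvy
    · simp [hx v, hy v]
    rw [Equiv.swap_apply_of_ne_of_ne hvx hvy]
  have key : ∀ q : P × Finset P, q ∈ cherries l r →
      (Equiv.swap x y q.1, q.2.map (Equiv.swap x y).toEmbedding) ∈ cherries l r := by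
    intro q hq
    rw [mem_cherries] at hq ⊢
    simp only [card_map, mem_map, Equiv.coe_toEmbedding, forall_exists_index, and_imp,
      forall_apply_eq_imp_iff₂, hs]
    exact hq
  refine Finset.card_bij'
    (fun q _ => (Equiv.swap x y q.1, q.2.map (Equiv.swap x y).toEmbedding))
    (fun q _ => (Equiv.swap x y q.1, q.2.map (Equiv.swap x y).toEmbedding)) ?_ ?_ ?_ ?_
  · intro q hq
    simp only [mem_filter] at hq ⊢
    refine ⟨key q hq.1, ?_⟩
    simpa [Finset.mem_map_equiv, and_comm] using hq.2
  · intro q hq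
    simp only [mem_filter] at hq ⊢
    refine ⟨key q hq.1, ?_⟩
    simpa [Finset.mem_map_equiv, and_comm] using hq.2
  · intro q hq
    ext <;> simp [Finset.mem_map_equiv]
  · intro q hq
    ext <;> simp [Finset.mem_map_equiv]

open Classical in
theorem cnt_eq_sum_filter (l : ℕ) (r : P → P → Prop) (x y : P) :
    cnt l r = ((cherries l r).filter fun q => x ∉ q.2 ∧ y ∉ q.2).card +
      ((cherries l r).filter fun q => x ∈ q.2 ∧ y ∉ q.2).card +
      ((cherries l r).filter fun q => x ∉ q.2 ∧ y ∈ q.2).card +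
      ((cherries l r).filter fun q => x ∈ q.2 ∧ y ∈ q.2).card := by
  have h1 := Finset.card_filter_add_card_filter_not (s := cherries l r) (fun q => x ∈ q.2)
  have h2 := Finset.card_filter_add_card_filter_not
    (s := (cherries l r).filter fun q => x ∈ q.2) (fun q => y ∈ q.2)
  have h3 := Finset.card_filter_add_card_filter_not
    (s := (cherries l r).filter fun q => x ∉ q.2) (fun q => y ∈ q.2)
  simp only [Finset.filter_filter] at h2 h3
  unfold cnt
  omega

/-- Replacing one of two maximal elements by a clone of the other: the two possible replacements
gain on average, with an excess given by the new cherries containing both elements. -/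
theorem two_mul_cnt_add_le {l : ℕ} {r r₁ r₂ : P → P → Prop} {x y : P}
    (hx : IsMaxFor r x) (hy : IsMaxFor r y) (hx₁ : IsMaxFor r₁ x) (hy₁ : IsMaxFor r₁ y)
    (hx₂ : IsMaxFor r₂ x) (hy₂ : IsMaxFor r₂ y)
    (h₁ : ∀ u v, v ≠ x → v ≠ y → (r₁ u v ↔ r u v)) (h₂ : ∀ u v, v ≠ x → v ≠ y → (r₂ u v ↔ r u v))
    (h₁x : ∀ u, r₁ u x ↔ r u x) (h₁y : ∀ u, r₁ u y ↔ r u x)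
    (h₂x : ∀ u, r₂ u x ↔ r u y) (h₂y : ∀ u, r₂ u y ↔ r u y)
    (E₁ E₂ : Finset (P × Finset P))
    (hE₁ : ∀ q ∈ E₁, q ∈ cherries l r₁ ∧ q ∉ cherries l r ∧ x ∈ q.2 ∧ y ∈ q.2)
    (hE₂ : ∀ q ∈ E₂, q ∈ cherries l r₂ ∧ q ∉ cherries l r ∧ x ∈ q.2 ∧ y ∈ q.2) :
    2 * cnt l r + E₁.card + E₂.card ≤ cnt l r₁ + cnt l r₂ := by
  classical
  have e₁ := cnt_eq_sum_filter l r₁ x y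
  have e₂ := cnt_eq_sum_filter l r₂ x y
  have e := cnt_eq_sum_filter l r x y
  have s₁ := card_filter_swap (l := l) hx₁ hy₁ (fun u => (h₁x u).trans (h₁y u).symm)
  have s₂ := card_filter_swap (l := l) hx₂ hy₂ (fun u => (h₂x u).trans (h₂y u).symm)
  have agree : ∀ (r' : P → P → Prop) (q : P × Finset P), (∀ u, ∀ v ∈ q.2, (r' u v ↔ r u v)) →
      (q ∈ cherries l r' ↔ q ∈ cherries l r) := by
    intro r' q h
    rw [mem_cherries, mem_cherries]
    refine and_congr Iff.rfl (and_congr ?_ ?_)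
    · exact forall₂_congr fun s hs => h _ s hs
    · exact forall₂_congr fun s hs => forall₂_congr fun t ht => not_congr (h _ t ht)
  have n₁ : (cherries l r₁).filter (fun q => x ∉ q.2 ∧ y ∉ q.2) =
      (cherries l r).filter (fun q => x ∉ q.2 ∧ y ∉ q.2) := by
    ext q
    simp only [mem_filter]
    refine and_congr_left fun hq => agree _ _ fun u v hv => h₁ u v ?_ ?_
    · rintro rfl; exact hq.1 hv
    · rintro rfl; exact hq.2 hv
  have n₂ : (cherries l r₂).filter (fun q => x ∉ q.2 ∧ y ∉ q.2) =
      (cherries l r).filter (fun q => x ∉ q.2 ∧ y ∉ q.2) := by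
    ext q
    simp only [mem_filter]
    refine and_congr_left fun hq => agree _ _ fun u v hv => h₂ u v ?_ ?_
    · rintro rfl; exact hq.1 hv
    · rintro rfl; exact hq.2 hv
  have x₁ : (cherries l r₁).filter (fun q => x ∈ q.2 ∧ y ∉ q.2) =
      (cherries l r).filter (fun q => x ∈ q.2 ∧ y ∉ q.2) := by
    ext q
    simp only [mem_filter]
    refine and_congr_left fun hq => agree _ _ fun u v hv => ?_
    rcases eq_or_ne v x with rfl | hvx
    · exact h₁x u
    · refine h₁ u v hvx ?_
      rintro rfl; exact hq.2 hv
  have y₂ : (cherries l r₂).filter (fun q => x ∉ q.2 ∧ y ∈ q.2) =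
      (cherries l r).filter (fun q => x ∉ q.2 ∧ y ∈ q.2) := by
    ext q
    simp only [mem_filter]
    refine and_congr_left fun hq => agree _ _ fun u v hv => ?_
    rcases eq_or_ne v y with rfl | hvy
    · exact h₂y u
    · refine h₂ u v ?_ hvy
      rintro rfl; exact hq.1 hv
  -- A cherry containing both `x` and `y` contains `z`, whose down-set both now carry, so it
  -- survives the cloning.
  have both : ∀ (r' : P → P → Prop) (z : P), (z = x ∨ z = y) → IsMaxFor r' x → IsMaxFor r' y →
      (∀ u v, v ≠ x → v ≠ y → (r' u v ↔ r u v)) → (∀ u, r' u x ↔ r u z) →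
      (∀ u, r' u y ↔ r u z) → ∀ E : Finset (P × Finset P),
      (∀ q ∈ E, q ∈ cherries l r' ∧ q ∉ cherries l r ∧ x ∈ q.2 ∧ y ∈ q.2) →
      ((cherries l r).filter fun q => x ∈ q.2 ∧ y ∈ q.2).card + E.card ≤
        ((cherries l r').filter fun q => x ∈ q.2 ∧ y ∈ q.2).card := by
    intro r' z hz hx' hy' h' h'x h'y E hE
    rw [← Finset.card_union_of_disjoint]
    · refine Finset.card_le_card fun q hq => ?_
      rw [mem_union] at hq
      rcases hq with hq | hq
      · simp only [mem_filter] at hq ⊢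
        obtain ⟨hq, hqx, hqy⟩ := hq
        refine ⟨?_, hqx, hqy⟩
        rw [mem_cherries] at hq ⊢
        have hzq : z ∈ q.2 := by rcases hz with rfl | rfl <;> assumption
        refine ⟨hq.1, fun s hs => ?_, fun s hs t ht => ?_⟩
        · rcases eq_or_ne s x with rfl | hsx
          · exact (h'x _).2 (hq.2.1 z hzq)
          rcases eq_or_ne s y with rfl | hsy
          · exact (h'y _).2 (hq.2.1 z hzq)
          exact (h' _ _ hsx hsy).2 (hq.2.1 s hs)
        · rcases eq_or_ne t x with rfl | hsx
          · rw [h'x]; exact hq.2.2 s hs z hzq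
          rcases eq_or_ne t y with rfl | hsy
          · rw [h'y]; exact hq.2.2 s hs z hzq
          rw [h' _ _ hsx hsy]; exact hq.2.2 s hs t ht
      · obtain ⟨a, -, b, c⟩ := hE q hq
        simp only [mem_filter]
        exact ⟨a, b, c⟩
    · rw [Finset.disjoint_left]
      intro q hq hq'
      exact (hE q hq').2.1 (mem_filter.1 hq).1
  have b₁ := both r₁ x (Or.inl rfl) hx₁ hy₁ h₁ h₁x h₁y E₁ hE₁
  have b₂ := both r₂ y (Or.inr rfl) hx₂ hy₂ h₂ h₂x h₂y E₂ hE₂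
  -- Cherries with exactly one of `x`, `y` number twice the `x`-only ones of `r` under `r₁`, and
  -- twice the `y`-only ones under `r₂`. In the sum they balance `2 * cnt l r`, so only cherries
  -- with both elements contribute a surplus.
  rw [n₁, x₁] at e₁
  rw [n₂, y₂] at e₂
  rw [x₁] at s₁
  rw [y₂] at s₂
  omega

end counting

/-! ### Redirecting down-sets of maximal elements -/

section cloning

variable {P : Type*} {r : P → P → Prop}

/-- Redirected elements are maximal and stay so; no chain passes through them, and transitivity
cannot break. -/
theorem StrictOrd.pull (hr : StrictOrd r) {ρ : P → P} (hρ : ∀ v, ρ v ≠ v → IsMaxFor r v) :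
    StrictOrd fun u v => r u (ρ v) where
  irrefl a h := by
    by_cases ha : ρ a = a
    · rw [ha] at h; exact hr.irrefl a h
    · exact hρ a ha _ h
  trans a b c h₁ h₂ := by
    have hb : ρ b = b := by
      by_contra hb
      exact hρ b hb _ h₂
    rw [hb] at h₁
    exact hr.trans _ _ _ h₁ h₂

theorem Layered.rel_iff (h : Layered r) {u v : P} (hv : IsMaxFor r v) : r u v ↔ ¬ IsMaxFor r u :=
  ⟨fun huv hu => hu v huv, h u v hv⟩

variable [Fintype P]

/-- In an optimal order every maximal element occurs in the antichain of some cherry. -/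
theorem exists_cherry_mem_of_optimal {l : ℕ} (hl : 1 ≤ l) (hr : StrictOrd r)
    (hopt : ∀ r' : P → P → Prop, StrictOrd r' → cnt l r' ≤ cnt l r) (hpos : 0 < cnt l r)
    {t : P} (ht : IsMaxFor r t) : ∃ q ∈ cherries l r, t ∈ q.2 := by
  classical
  by_contra! h
  obtain ⟨⟨b, S⟩, hq⟩ := Finset.card_pos.1 hpos
  have htS := h _ hq
  have hq' := mem_cherries.1 hq
  simp only at hq' htS
  obtain ⟨s, hs⟩ : S.Nonempty := Finset.card_pos.1 (by omega)
  have hst : s ≠ t := by rintro rfl; exact htS hs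
  -- Make `t` a clone of `s`. No cherry has `t` in its antichain, so none is lost, while exchanging
  -- `s` for `t` in `S` yields a new one.
  let r' : P → P → Prop := fun u v => r u (if v = t then s else v)
  have hr' : StrictOrd r' := hr.pull fun v hv => by
    split_ifs at hv with hvt
    · rwa [hvt]
    · exact absurd rfl hv
  have e₁ : ∀ u v, v ≠ t → (r' u v ↔ r u v) := fun u v hv => by simp [r', hv]
  have e₂ : ∀ u, r' u t ↔ r u s := fun u => by simp [r']
  have hsub : cherries l r ⊆ (cherries l r').erase (b, insert t (S.erase s)) := by
    intro p hp
    have htp := h _ hp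
    rw [mem_erase]
    refine ⟨?_, ?_⟩
    · rintro rfl
      exact htp (mem_insert_self _ _)
    have hne : ∀ v ∈ p.2, v ≠ t := by
      rintro v hv rfl; exact htp hv
    rw [mem_cherries] at hp ⊢
    refine ⟨hp.1, fun s hs => (e₁ _ _ (hne s hs)).2 (hp.2.1 s hs), fun s hs v hv => ?_⟩
    rw [e₁ _ _ (hne v hv)]
    exact hp.2.2 s hs v hv
  have hmem : (b, insert t (S.erase s)) ∈ cherries l r' := by
    rw [mem_cherries]
    refine ⟨?_, ?_, ?_⟩
    · rw [card_insert_of_notMem (fun h => htS (mem_of_mem_erase h)), card_erase_add_one hs, hq'.1]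
    · intro u hu
      rw [mem_insert] at hu
      rcases hu with rfl | hu
      · exact (e₂ b).2 (hq'.2.1 s hs)
      · have hu := mem_of_mem_erase hu
        exact (e₁ _ _ (by rintro rfl; exact htS hu)).2 (hq'.2.1 u hu)
    · have key : ∀ u ∈ insert t (S.erase s), ∀ v ∈ S, ¬ r u v := by
        intro u hu v hv
        rw [mem_insert] at hu
        rcases hu with rfl | hu
        · exact ht v
        · exact hq'.2.2 u (mem_of_mem_erase hu) v hv
      intro u hu v hv
      rw [mem_insert] at hv
      rcases hv with rfl | hv
      · rw [e₂]; exact key u hu s hs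
      · have hv := mem_of_mem_erase hv
        rw [e₁ _ _ (by rintro rfl; exact htS hv)]
        exact key u hu v hv
  have h1 := Finset.card_le_card hsub
  rw [card_erase_of_mem hmem] at h1
  have h2 := hopt r' hr'
  have h3 : 0 < #(cherries l r') := Finset.card_pos.2 ⟨_, hmem⟩
  unfold cnt at h2
  omega

/-- Some cherry has `t` in its antichain. By layeredness a non-maximal member would lie below `t`,
so the whole antichain is maximal. -/
theorem Layered.le_card_tops_of_optimal {l : ℕ} (hl : 1 ≤ l) (hr : StrictOrd r) (hlay : Layered r)
    (hopt : ∀ r' : P → P → Prop, StrictOrd r' → cnt l r' ≤ cnt l r) (hpos : 0 < cnt l r)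
    {t : P} (ht : IsMaxFor r t) : l ≤ (tops r).card := by
  obtain ⟨q, hq, htq⟩ := exists_cherry_mem_of_optimal hl hr hopt hpos ht
  rw [mem_cherries] at hq
  rw [← hq.1]
  refine Finset.card_le_card fun s hs => mem_tops.2 ?_
  by_contra hs'
  exact hq.2.2 s hs t htq (hlay s t ht hs')

/-! ### Classes of maximal elements and the stages between two merges -/

open Classical in
/-- The maximal elements with the same elements below as `a`. -/
noncomputable def cls (r : P → P → Prop) (a : P) : Finset P :=
  univ.filter fun v => IsMaxFor r v ∧ ∀ u, r u v ↔ r u a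

theorem mem_cls {a v : P} : v ∈ cls r a ↔ IsMaxFor r v ∧ ∀ u, r u v ↔ r u a := by simp [cls]

open Classical in
/-- Turn all elements of the class of `a` into clones of `b`. -/
def merge (r : P → P → Prop) (a b : P) : P → P → Prop :=
  fun u v => r u (if v ∈ cls r a then b else v)

open Classical in
/-- Among the elements in the class of `a` or of `b`, those of rank below `i` become clones of `a`,
the others clones of `b`. -/
def stage (r : P → P → Prop) (a b : P) (rk : P → ℕ) (i : ℕ) : P → P → Prop :=
  fun u v => r u (if v ∈ cls r a ∪ cls r b then (if rk v < i then a else b) else v)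

open Classical in
/-- `rk` numbers the class of `a` by `0, …, p - 1` and the class of `b` by `p, …, m - 1`. -/
structure IsRanking (r : P → P → Prop) (a b : P) (rk : P → ℕ) (p m : ℕ) : Prop where
  pos : 0 < p
  lt : p < m
  rk_lt : ∀ v ∈ cls r a ∪ cls r b, rk v < m
  rk_lt_iff : ∀ v ∈ cls r a ∪ cls r b, (rk v < p ↔ v ∈ cls r a)
  surj : ∀ i < m, ∃ v ∈ cls r a ∪ cls r b, rk v = i
  card : (cls r a ∪ cls r b).card = m

theorem exists_isRanking {a b : P} (ha : IsMaxFor r a) (hb : IsMaxFor r b)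
    (hab : ¬ ∀ u, r u a ↔ r u b) : ∃ rk p m, IsRanking r a b rk p m := by
  classical
  have hdis : ∀ v ∈ cls r b, v ∉ cls r a := by
    intro v hv hv'
    rw [mem_cls] at hv hv'
    exact hab fun u => (hv'.2 u).symm.trans (hv.2 u)
  let eA := (cls r a).equivFin
  let eB := (cls r b).equivFin
  let rk : P → ℕ := fun v => if h : v ∈ cls r a then eA ⟨v, h⟩ else
    if h : v ∈ cls r b then (cls r a).card + eB ⟨v, h⟩ else 0
  have rkA : ∀ v (h : v ∈ cls r a), rk v = eA ⟨v, h⟩ := fun v h => by simp [rk, h]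
  have rkB : ∀ v (h : v ∈ cls r b), rk v = (cls r a).card + eB ⟨v, h⟩ := fun v h => by
    simp [rk, h, hdis v h]
  have hA : 0 < (cls r a).card := Finset.card_pos.2 ⟨a, mem_cls.2 ⟨ha, fun _ => Iff.rfl⟩⟩
  have hB : 0 < (cls r b).card := Finset.card_pos.2 ⟨b, mem_cls.2 ⟨hb, fun _ => Iff.rfl⟩⟩
  refine ⟨rk, (cls r a).card, (cls r a).card + (cls r b).card, hA, by omega, ?_, ?_, ?_, ?_⟩
  · intro v hv
    rw [mem_union] at hv
    rcases hv with hv | hv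
    · rw [rkA v hv]; omega
    · rw [rkB v hv]; omega
  · intro v hv
    rw [mem_union] at hv
    rcases hv with hv | hv
    · rw [rkA v hv]; simp [hv]
    · rw [rkB v hv]; simp [hdis v hv]
  · intro i hi
    by_cases h : i < (cls r a).card
    · refine ⟨eA.symm ⟨i, h⟩, mem_union_left _ (eA.symm ⟨i, h⟩).2, ?_⟩
      rw [rkA _ (eA.symm ⟨i, h⟩).2]
      simp
    · have h' : i - (cls r a).card < (cls r b).card := by omega
      refine ⟨eB.symm ⟨_, h'⟩, mem_union_right _ (eB.symm ⟨_, h'⟩).2, ?_⟩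
      rw [rkB _ (eB.symm ⟨_, h'⟩).2]
      simp
      omega
  · rw [card_union_of_disjoint]
    exact (Finset.disjoint_left.2 hdis).symm

section

variable {a b : P} {rk : P → ℕ} {p m : ℕ}

open Classical in
theorem stage_of_lt {i : ℕ} {u v : P} (hv : v ∈ cls r a ∪ cls r b) (h : rk v < i) :
    stage r a b rk i u v ↔ r u a := by simp only [stage, if_pos hv, if_pos h]

open Classical in
theorem stage_of_le {i : ℕ} {u v : P} (hv : v ∈ cls r a ∪ cls r b) (h : i ≤ rk v) :
    stage r a b rk i u v ↔ r u b := by simp only [stage, if_pos hv, if_neg h.not_gt]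

open Classical in
theorem stage_of_notMem {i : ℕ} {u v : P} (hv : v ∉ cls r a ∪ cls r b) :
    stage r a b rk i u v ↔ r u v := by simp only [stage, if_neg hv]

theorem isMaxFor_stage {i : ℕ} {v : P} (hv : IsMaxFor r v) : IsMaxFor (stage r a b rk i) v :=
  fun _ => hv _

open Classical in
theorem isMaxFor_of_mem_union {v : P} (hv : v ∈ cls r a ∪ cls r b) : IsMaxFor r v := by
  rw [mem_union, mem_cls, mem_cls] at hv
  exact hv.elim And.left And.left

theorem strictOrd_stage (hr : StrictOrd r) (i : ℕ) : StrictOrd (stage r a b rk i) := by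
  classical
  refine hr.pull fun v hv => ?_
  split_ifs at hv with h1 h2
  · exact isMaxFor_of_mem_union h1
  · exact isMaxFor_of_mem_union h1
  · exact absurd rfl hv

theorem merge_iff_right {u v : P} (hv : v ∈ cls r a) : merge r a b u v ↔ r u b := by
  simp only [merge, if_pos hv]

theorem merge_iff {u v : P} (hv : v ∉ cls r a) : merge r a b u v ↔ r u v := by
  simp only [merge, if_neg hv]

theorem isMaxFor_merge {v : P} (hv : IsMaxFor r v) : IsMaxFor (merge r a b) v := fun _ => hv _

theorem strictOrd_merge (hr : StrictOrd r) (a b : P) : StrictOrd (merge r a b) := by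
  classical
  refine hr.pull fun v hv => ?_
  split_ifs at hv with h1
  · exact (mem_cls.1 h1).1
  · exact absurd rfl hv

theorem stage_zero : stage r a b rk 0 = merge r a b := by
  classical
  funext u v
  apply propext
  by_cases hv : v ∈ cls r a
  · rw [merge_iff_right hv, stage_of_le (mem_union_left _ hv) (Nat.zero_le _)]
  rw [merge_iff hv]
  by_cases hv' : v ∈ cls r b
  · rw [stage_of_le (mem_union_right _ hv') (Nat.zero_le _), (mem_cls.1 hv').2]
  · rw [stage_of_notMem (by simp [hv, hv'])]

theorem IsRanking.stage_last (h : IsRanking r a b rk p m) : stage r a b rk m = merge r b a := by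
  classical
  funext u v
  apply propext
  by_cases hv : v ∈ cls r b
  · have := mem_union_right (cls r a) hv
    rw [merge_iff_right hv, stage_of_lt this (h.rk_lt v this)]
  rw [merge_iff hv]
  by_cases hv' : v ∈ cls r a
  · have := mem_union_left (cls r b) hv'
    rw [stage_of_lt this (h.rk_lt v this), (mem_cls.1 hv').2]
  · rw [stage_of_notMem (by simp [hv, hv'])]

theorem IsRanking.stage_self (h : IsRanking r a b rk p m) : stage r a b rk p = r := by
  classical
  funext u v
  apply propext
  by_cases hv : v ∈ cls r a ∪ cls r b
  · by_cases hv' : v ∈ cls r a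
    · rw [stage_of_lt hv ((h.rk_lt_iff v hv).2 hv'), (mem_cls.1 hv').2]
    · rw [stage_of_le hv (not_lt.1 (mt (h.rk_lt_iff v hv).1 hv'))]
      rw [mem_union, or_iff_right hv'] at hv
      rw [(mem_cls.1 hv).2]
  · rw [stage_of_notMem hv]

open Classical in
theorem IsRanking.rk_injOn (h : IsRanking r a b rk p m) {v w : P} (hv : v ∈ cls r a ∪ cls r b)
    (hw : w ∈ cls r a ∪ cls r b) (hvw : rk v = rk w) : v = w := by
  refine Finset.injOn_of_card_image_eq (s := cls r a ∪ cls r b) (f := rk) ?_ hv hw hvw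
  have : (cls r a ∪ cls r b).image rk = range m := by
    ext i
    simp only [mem_image, mem_range]
    exact ⟨fun ⟨v, hv, e⟩ => e ▸ h.rk_lt v hv, h.surj i⟩
  rw [this, card_range, h.card]

-- Stages `i`, `i + 1`, `i + 2` differ only at `x` and `y`: both clones of `b`, then one of each,
-- then both clones of `a`. `E₂` and `E₁` collect cherries that exist only in the outer stages.
open Classical in
theorem IsRanking.convex_add (h : IsRanking r a b rk p m) (l : ℕ) {i : ℕ} {x y : P}
    (hx : x ∈ cls r a ∪ cls r b) (hy : y ∈ cls r a ∪ cls r b) (hxi : rk x = i) (hyi : rk y = i + 1)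
    (E₁ E₂ : Finset (P × Finset P))
    (hE₁ : ∀ q ∈ E₁, q ∈ cherries l (stage r a b rk (i + 2)) ∧
      q ∉ cherries l (stage r a b rk (i + 1)) ∧ x ∈ q.2 ∧ y ∈ q.2)
    (hE₂ : ∀ q ∈ E₂, q ∈ cherries l (stage r a b rk i) ∧
      q ∉ cherries l (stage r a b rk (i + 1)) ∧ x ∈ q.2 ∧ y ∈ q.2) :
    2 * cnt l (stage r a b rk (i + 1)) + E₁.card + E₂.card ≤
      cnt l (stage r a b rk (i + 2)) + cnt l (stage r a b rk i) := by
  have hxt := isMaxFor_of_mem_union hx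
  have hyt := isMaxFor_of_mem_union hy
  have key : ∀ j, (j = i ∨ j = i + 2) → ∀ u v, v ≠ x → v ≠ y →
      (stage r a b rk j u v ↔ stage r a b rk (i + 1) u v) := by
    intro j hj u v hvx hvy
    by_cases hv : v ∈ cls r a ∪ cls r b
    · have h1 : rk v ≠ i := fun e => hvx (h.rk_injOn hv hx (e.trans hxi.symm))
      have h2 : rk v ≠ i + 1 := fun e => hvy (h.rk_injOn hv hy (e.trans hyi.symm))
      rcases lt_or_ge (rk v) i with h3 | h3
      · rw [stage_of_lt hv (by omega), stage_of_lt hv (by omega)]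
      · rw [stage_of_le hv (by omega), stage_of_le hv (by omega)]
    · rw [stage_of_notMem hv, stage_of_notMem hv]
  refine two_mul_cnt_add_le (isMaxFor_stage hxt) (isMaxFor_stage hyt) (isMaxFor_stage hxt) (isMaxFor_stage hyt)
    (isMaxFor_stage hxt) (isMaxFor_stage hyt) (key _ (Or.inr rfl)) (key _ (Or.inl rfl)) ?_ ?_ ?_ ?_
    E₁ E₂ hE₁ hE₂
  · intro u; rw [stage_of_lt hx (by omega), stage_of_lt hx (by omega)]
  · intro u; rw [stage_of_lt hy (by omega), stage_of_lt hx (by omega)]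
  · intro u; rw [stage_of_le hx (by omega), stage_of_le hy (by omega)]
  · intro u; rw [stage_of_le hy (by omega), stage_of_le hy (by omega)]

theorem IsRanking.convex_cnt (h : IsRanking r a b rk p m) (l : ℕ) {i : ℕ} (hi : i + 1 < m) :
    2 * cnt l (stage r a b rk (i + 1)) ≤
      cnt l (stage r a b rk (i + 2)) + cnt l (stage r a b rk i) := by
  classical
  obtain ⟨x, hx, hxi⟩ := h.surj i (by omega)
  obtain ⟨y, hy, hyi⟩ := h.surj (i + 1) hi
  simpa using h.convex_add l hx hy hxi hyi ∅ ∅ (by simp) (by simp)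

end

/-! ### Strict convexity next to a layered optimal merge -/

section layeredMerge

variable {a b : P}

/-- After the merge `b` is still maximal, so a non-maximal `n` would lie below it. Hence `n` becomes
maximal, and in a layered order all maximal elements share one down-set. -/
theorem Layered.below_of_not_rel (hlay : Layered (merge r a b)) (hb : IsMaxFor r b)
    (hab : ¬ ∀ u, r u a ↔ r u b) {n : P} (hna : r n a) (hnb : ¬ r n b) :
    IsMaxFor (merge r a b) n ∧ ∀ u, r u n ↔ r u b := by
  have hb' : b ∉ cls r a := fun h => hab fun u => ((mem_cls.1 h).2 u).symm
  have hn : n ∉ cls r a := fun h => (mem_cls.1 h).1 _ hna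
  have htop : IsMaxFor (merge r a b) n := by
    by_contra hn'
    exact hnb ((merge_iff hb').1 (hlay n b (isMaxFor_merge hb) hn'))
  refine ⟨htop, fun u => ?_⟩
  rw [← merge_iff (b := b) hn, hlay.rel_iff htop, ← hlay.rel_iff (isMaxFor_merge hb), merge_iff hb']

-- A third class would survive the merge with its own down-set, against layeredness.
open Classical in
theorem Layered.mem_union_of_isMaxFor (hlay : Layered (merge r a b)) (hb : IsMaxFor r b)
    (hab : ¬ ∀ u, r u a ↔ r u b) {v : P} (hv : IsMaxFor r v) : v ∈ cls r a ∪ cls r b := by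
  have hb' : b ∉ cls r a := fun h => hab fun u => ((mem_cls.1 h).2 u).symm
  by_cases hva : v ∈ cls r a
  · exact mem_union_left _ hva
  refine mem_union_right _ (mem_cls.2 ⟨hv, fun u => ?_⟩)
  rw [← merge_iff (b := b) hva, hlay.rel_iff (isMaxFor_merge hv),
    ← hlay.rel_iff (isMaxFor_merge hb), merge_iff hb']

theorem IsRanking.strict_convex_one {l : ℕ} (hl : 2 ≤ l) {rk : P → ℕ} {p m : ℕ}
    (h : IsRanking r a b rk p m) (hr : StrictOrd r)
    (hb : IsMaxFor r b) (hab : ¬ ∀ u, r u a ↔ r u b)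
    (hlay : Layered (merge r a b))
    (hopt : ∀ r' : P → P → Prop, StrictOrd r' → cnt l r' ≤ cnt l (merge r a b))
    (hpos : 0 < cnt l (merge r a b)) :
    2 * cnt l (stage r a b rk 1) + 1 ≤ cnt l (stage r a b rk 2) + cnt l (stage r a b rk 0) := by
  classical
  have hpm := h.pos
  have hpm' := h.lt
  obtain ⟨x, hx, hxi⟩ := h.surj 0 (by omega)
  obtain ⟨y, hy, hyi⟩ := h.surj 1 (by omega)
  have hxt := isMaxFor_of_mem_union hx
  have hyt := isMaxFor_of_mem_union hy
  have hxy : x ≠ y := by rintro rfl; omega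
  have hb' : b ∉ cls r a := fun h => hab fun u => ((mem_cls.1 h).2 u).symm
  have hs := strictOrd_merge hr a b
  have hcard := hlay.le_card_tops_of_optimal (by omega) hs hopt hpos (isMaxFor_merge hb)
  have hmk : ∀ (β : P) (S : Finset P), r β b → S ⊆ tops (merge r a b) → S.card = l →
      (β, S) ∈ cherries l (stage r a b rk 0) := by
    intro β S hβ hS hSl
    rw [mem_cherries, stage_zero]
    refine ⟨hSl, fun s hs => ?_, fun s hs t _ => mem_tops.1 (hS hs) t⟩
    exact hlay _ _ (mem_tops.1 (hS hs)) fun hβ' => hβ' b ((merge_iff hb').2 hβ)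
  have hxT : x ∈ tops (merge r a b) := mem_tops.2 (isMaxFor_merge hxt)
  have hyT : y ∈ tops (merge r a b) := mem_tops.2 (isMaxFor_merge hyt)
  by_cases hN : ∃ n, r n a ∧ ¬ r n b
  · obtain ⟨n, hna, hnb⟩ := hN
    have hn := (hlay.below_of_not_rel hb hab hna hnb).1
    -- For `l = 2` the pair `{x, y}` above `n` is a cherry at stage 2 only.
    rcases hl.eq_or_lt with rfl | hl3
    · have := h.convex_add 2 hx hy hxi hyi {(n, {x, y})} ∅ (fun q hq => ?_) (by simp)
      · simpa using this
      rw [mem_singleton] at hq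
      subst hq
      refine ⟨?_, ?_, by simp, by simp⟩
      · rw [mem_cherries]
        refine ⟨card_pair hxy, fun s hs => ?_, fun s hs t _ => ?_⟩
        · simp only [mem_insert, mem_singleton] at hs
          rcases hs with rfl | rfl
          · exact (stage_of_lt hx (by omega)).2 hna
          · exact (stage_of_lt hy (by omega)).2 hna
        · simp only [mem_insert, mem_singleton] at hs
          rcases hs with rfl | rfl
          · exact isMaxFor_stage hxt t
          · exact isMaxFor_stage hyt t
      · rw [mem_cherries]
        intro hq
        exact hnb ((stage_of_le hy (by omega)).1 (hq.2.1 y (by simp)))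
    · obtain ⟨q, hq, hbq⟩ := exists_cherry_mem_of_optimal (by omega) hs hopt hpos (isMaxFor_merge hb)
      have hβ := (merge_iff hb').1 ((mem_cherries.1 hq).2.1 b hbq)
      -- For `l ≥ 3` there is room for `x`, `y` and `n` in one antichain of maximal elements at
      -- stage 0; at stage 1 it is destroyed by `n` lying below `x`.
      obtain ⟨S, hS1, hS2, hS3⟩ := Finset.exists_subsuperset_card_eq
        (s := {x, y, n}) (t := tops (merge r a b)) (n := l)
        (by
          intro z hz
          simp only [mem_insert, mem_singleton] at hz
          rcases hz with rfl | rfl | rfl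
          · exact hxT
          · exact hyT
          · exact mem_tops.2 hn) (card_le_three.trans hl3) hcard
      have := h.convex_add l hx hy hxi hyi ∅ {(q.1, S)} (by simp) (fun q' hq' => ?_)
      · simpa using this
      rw [mem_singleton] at hq'
      subst hq'
      refine ⟨hmk _ _ hβ hS2 hS3, ?_, hS1 (by simp), hS1 (by simp)⟩
      rw [mem_cherries]
      intro hq
      exact hq.2.2 n (hS1 (by simp)) x (hS1 (by simp)) ((stage_of_lt hx (by omega)).2 hna)
  · push Not at hN
    obtain ⟨β, hβb, hβa⟩ : ∃ β, r β b ∧ ¬ r β a := by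
      by_contra! hc
      exact hab fun u => ⟨hN u, hc u⟩
    -- Here `β` lies below every maximal element at stage 0, but no longer below `x` at stage 1.
    obtain ⟨S, hS1, hS2, hS3⟩ := Finset.exists_subsuperset_card_eq
      (s := {x, y}) (t := tops (merge r a b)) (n := l)
      (by
        intro z hz
        simp only [mem_insert, mem_singleton] at hz
        rcases hz with rfl | rfl
        · exact hxT
        · exact hyT) (card_le_two.trans hl) hcard
    have := h.convex_add l hx hy hxi hyi ∅ {(β, S)} (by simp) (fun q' hq' => ?_)
    · simpa using this
    rw [mem_singleton] at hq'
    subst hq'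
    refine ⟨hmk _ _ hβb hS2 hS3, ?_, hS1 (by simp), hS1 (by simp)⟩
    rw [mem_cherries]
    intro hq
    exact hβa ((stage_of_lt hx (by omega)).1 (hq.2.1 x (hS1 (by simp))))

end layeredMerge

end cloning

/-! ### Convex integer sequences close to their maximum -/

section convexSequences

variable {G : ℕ → ℤ} {m : ℕ}

theorem convex_diff_mono (hG : ∀ i, i + 1 < m → 2 * G (i + 1) ≤ G (i + 2) + G i) {i j : ℕ}
    (hij : i ≤ j) (hj : j < m) : G (i + 1) - G i ≤ G (j + 1) - G j := by
  induction j, hij using Nat.le_induction with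
  | base => exact le_rfl
  | succ k hk ih =>
    have h1 := ih (by omega)
    have h2 := hG k hj
    have : k + 1 + 1 = k + 2 := rfl
    rw [this]
    linarith

theorem convex_lower (hG : ∀ i, i + 1 < m → 2 * G (i + 1) ≤ G (i + 2) + G i) {i j : ℕ} {c : ℤ}
    (hc : c ≤ G (i + 1) - G i) (hij : i ≤ j) (hj : j ≤ m) : c * (j - i) ≤ G j - G i := by
  induction j, hij using Nat.le_induction with
  | base => simp
  | succ k hk ih =>
    have h1 := ih (by omega)
    have h2 := convex_diff_mono hG hk (by omega)
    push_cast
    linarith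

theorem convex_upper (hG : ∀ i, i + 1 < m → 2 * G (i + 1) ≤ G (i + 2) + G i) {i j : ℕ} {c : ℤ}
    (hj : j < m) (hc : G (j + 1) - G j ≤ c) (hij : i ≤ j + 1) :
    G (j + 1) - G i ≤ c * (j + 1 - i) := by
  obtain ⟨k, hk⟩ := Nat.exists_eq_add_of_le hij
  induction k generalizing i with
  | zero =>
    obtain rfl : j + 1 = i := hk
    simp
  | succ k ih =>
    have h1 := ih (i := i + 1) (by omega) (by omega)
    have h2 := convex_diff_mono hG (show i ≤ j by omega) hj
    push_cast at h1
    linarith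

/-- The step into `p` cannot be positive, or the next value would exceed `M`. So all earlier steps
are nonpositive, and values to the left of `p` are at least `M`. -/
theorem convex_eq_max_left (hG : ∀ i, i + 1 < m → 2 * G (i + 1) ≤ G (i + 2) + G i) {M : ℤ}
    (hM : ∀ i, G i ≤ M) {p : ℕ} (hpm : p < m) (hp : G p = M) :
    ∀ i ≤ p, G i = M := by
  intro i hi
  rcases hi.eq_or_lt with rfl | hi
  · exact hp
  obtain ⟨p, rfl⟩ : ∃ p', p = p' + 1 := ⟨p - 1, by omega⟩
  have h0 : G (p + 1) - G p ≤ 0 := by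
    have := hG p hpm
    have := hM (p + 2)
    linarith
  have h1 := convex_upper hG (show p < m by omega) h0 hi.le
  have := hM i
  linarith

/-- A convex sequence that is one below its upper bound at an interior point takes a value close to
the bound at one of its ends. -/
theorem convex_le_end (hG : ∀ i, i + 1 < m → 2 * G (i + 1) ≤ G (i + 2) + G i) {p : ℕ}
    (hp0 : 0 < p) (hpm : p < m) (h0 : G 0 < G p) : G p < G m := by
  obtain ⟨p, rfl⟩ : ∃ p', p = p' + 1 := ⟨p - 1, by omega⟩
  have h1 : 1 ≤ G (p + 1) - G p := by
    by_contra! h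
    have := convex_upper hG (show p < m by omega) (show G (p + 1) - G p ≤ 0 by omega)
      (Nat.zero_le _)
    linarith
  have h2 := convex_diff_mono hG (Nat.le_succ p) hpm
  have h3 := convex_lower hG (i := p + 1) (h1.trans h2) hpm.le le_rfl
  omega

/-- If the right end were lower, the step out of `p` would be negative, hence all earlier ones too.
A total drop of 1 leaves only `p = 1`, and two negative steps contradict strictness at 1. -/
theorem convex_left_end (hG : ∀ i, i + 1 < m → 2 * G (i + 1) ≤ G (i + 2) + G i) {M : ℤ} {p : ℕ}
    (hp0 : 0 < p) (hpm : p < m) (h0 : G 0 = M) (hp : G p = M - 1)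
    (h1 : 2 * G 1 + 1 ≤ G 2 + G 0) : M - 1 ≤ G m := by
  by_contra! hm
  have hd : G (p + 1) - G p ≤ -1 := by
    by_contra! h
    have := convex_lower hG (i := p) (show 0 ≤ G (p + 1) - G p by omega) hpm.le le_rfl
    linarith
  obtain ⟨p, rfl⟩ : ∃ p', p = p' + 1 := ⟨p - 1, by omega⟩
  have h2 := convex_diff_mono hG (Nat.le_succ p) hpm
  have h3 := convex_upper hG (show p < m by omega) (h2.trans hd) (Nat.zero_le _)
  obtain rfl : p = 0 := by push_cast at h3; omega
  simp only [zero_add] at *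
  have : (1 : ℕ) + 1 = 2 := rfl
  rw [this] at hd
  omega

theorem convex_two_ended (hG : ∀ i, i + 1 < m → 2 * G (i + 1) ≤ G (i + 2) + G i) {M : ℤ} {p : ℕ}
    (hp0 : 0 < p) (hpm : p < m) (h0 : G 0 = M) (hp : G p = M - 1) (hm : G m = M)
    (h1 : 2 * G 1 + 1 ≤ G 2 + G 0) (hm3 : 3 ≤ m)
    (h2 : 2 * G (m - 1) + 2 ≤ G m + G (m - 2)) : False := by
  obtain ⟨m, rfl⟩ : ∃ k, m = k + 2 := ⟨m - 2, by omega⟩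
  have e1 : m + 2 - 1 = m + 1 := rfl
  have e2 : m + 2 - 2 = m := rfl
  rw [e1, e2] at h2
  obtain ⟨p, rfl⟩ : ∃ p', p = p' + 1 := ⟨p - 1, by omega⟩
  -- A negative step out of the interior point forces that point to be 1, as in `convex_left_end`.
  -- The rest shows that the surplus 2 at the right end produces such a step, or else makes `m` too
  -- small.
  have fin : G (p + 2) - G (p + 1) ≤ -1 → False := by
    intro hd
    have h3 := convex_diff_mono hG (Nat.le_succ p) hpm
    have h4 := convex_upper hG (show p < m + 2 by omega) (h3.trans hd) (Nat.zero_le _)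
    obtain rfl : p = 0 := by push_cast at h4; omega
    simp only [zero_add] at *
    omega
  rcases Nat.lt_or_ge p m with hlt | hge
  · have hle : G (m + 1) ≤ M - 1 := by
      by_contra! h
      have h3 : 1 ≤ G (m + 1) - G m := by
        by_contra! h'
        have := convex_upper hG (j := m) (i := p + 1) (by omega)
          (show G (m + 1) - G m ≤ 0 by omega) (by omega)
        linarith
      have h4 := hG m (by omega)
      omega
    rcases hle.eq_or_lt with he | hlt'
    · have h3 : G (m + 1) - G m ≤ -1 := by omega
      have h4 := convex_diff_mono hG (show p + 1 ≤ m by omega) (by omega)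
      exact fin (h4.trans h3)
    · refine fin ?_
      by_contra! h
      have := convex_lower hG (i := p + 1) (j := m + 1)
        (show 0 ≤ G (p + 1 + 1) - G (p + 1) by
          have : p + 1 + 1 = p + 2 := rfl
          rw [this]; omega) (by omega) (by omega)
      linarith
  · obtain rfl : p = m := by omega
    have h3 := convex_upper hG (show p < p + 2 by omega) (show G (p + 1) - G p ≤ -1 by omega)
      (Nat.zero_le _)
    push_cast at h3
    omega

/-- Steps increase by at least `v`, and the sequence falls by 1 and then rises by 1 in total. With
at least three steps they can only be `-1, 0, 1`. -/
theorem strictConvex_two_ended {v : ℤ} (hv : 1 ≤ v)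
    (hG : ∀ i, i + 1 < m → 2 * G (i + 1) + v ≤ G (i + 2) + G i) {M : ℤ} {p : ℕ}
    (hM : ∀ i, G i ≤ M)
    (hp0 : 0 < p) (hpm : p < m) (h0 : G 0 = M) (hp : G p = M - 1) (hm : G m = M)
    (hm3 : 3 ≤ m) : m = 3 ∧ v = 1 ∧ G 1 = M - 1 := by
  have hG' : ∀ i, i + 1 < m → 2 * G (i + 1) ≤ G (i + 2) + G i := fun i hi => by
    have := hG i hi
    omega
  obtain ⟨p, rfl⟩ : ∃ p', p = p' + 1 := ⟨p - 1, by omega⟩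
  have hs := hG p hpm
  have hA : p = 0 ∨ 0 ≤ G (p + 1) - G p := by
    by_contra! h
    have := convex_upper hG' (show p < m by omega) (show G (p + 1) - G p ≤ -1 by omega)
      (Nat.zero_le _)
    push_cast at this
    omega
  have hB : m = p + 2 ∨ G (p + 2) - G (p + 1) ≤ 0 := by
    by_contra! h
    have := convex_lower hG' (i := p + 1) (show 1 ≤ G (p + 1 + 1) - G (p + 1) by
      have : p + 1 + 1 = p + 2 := rfl
      rw [this]; omega) hpm.le le_rfl
    push_cast at this
    omega
  rcases hA with rfl | hA
  · simp only [zero_add] at *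
    have h2 : G 2 = M - 1 := by
      rcases hB with rfl | hB
      · omega
      · omega
    have h3 := hG 1 (by omega)
    have h4 := hM 3
    norm_num at h3
    refine ⟨?_, by omega, hp⟩
    by_contra hm'
    have h5 := hG 2 (by omega)
    have h6 := hM 4
    norm_num at h5
    omega
  · obtain rfl : m = p + 2 := by omega
    obtain ⟨p, rfl⟩ : ∃ p', p = p' + 1 := ⟨p - 1, by omega⟩
    have e1 : p + 1 + 1 = p + 2 := rfl
    have e2 : p + 1 + 2 = p + 3 := rfl
    simp only [e1, e2] at *
    have h1 := hG p (by omega)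
    have h2 := hM p
    have hp' : p = 0 := by
      by_contra hp'
      obtain ⟨k, rfl⟩ : ∃ k, p = k + 1 := ⟨p - 1, by omega⟩
      have h3 := hG k (by omega)
      have h4 := hM k
      have e3 : k + 1 + 1 = k + 2 := rfl
      have e4 : k + 1 + 2 = k + 3 := rfl
      simp only [e3, e4] at *
      omega
    subst hp'
    simp only [zero_add] at *
    exact ⟨trivial, by omega, by omega⟩

end convexSequences

/-! ### Optimal and near-optimal orders -/

section nearOptimal

variable {P : Type*} [Fintype P] {r : P → P → Prop}

open Classical in
/-- The pairs of maximal elements with the same elements below. -/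
noncomputable def twins (r : P → P → Prop) : Finset (P × P) :=
  univ.filter fun q => IsMaxFor r q.1 ∧ IsMaxFor r q.2 ∧ ∀ u, r u q.1 ↔ r u q.2

/-- Merging keeps old twins and adds the pair `(a, b)`; this measure drives both inductions below.
-/
theorem card_twins_lt {a b : P} (ha : IsMaxFor r a) (hb : IsMaxFor r b)
    (hab : ¬ ∀ u, r u a ↔ r u b) : (twins r).card < (twins (merge r a b)).card := by
  have hb' : b ∉ cls r a := fun h => hab fun u => ((mem_cls.1 h).2 u).symm
  have ha' : a ∈ cls r a := mem_cls.2 ⟨ha, fun _ => Iff.rfl⟩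
  refine Finset.card_lt_card (Finset.ssubset_iff_exists_cons_subset.2 ⟨(a, b), ?_, ?_⟩)
  · simpa [twins, ha, hb] using hab
  · intro q hq
    rw [mem_cons] at hq
    simp only [twins, mem_filter, mem_univ, true_and] at hq ⊢
    rcases hq with rfl | ⟨h1, h2, h3⟩
    · refine ⟨isMaxFor_merge ha, isMaxFor_merge hb, fun u => ?_⟩
      rw [merge_iff_right ha', merge_iff hb']
    · refine ⟨isMaxFor_merge h1, isMaxFor_merge h2, fun u => ?_⟩
      by_cases hq : q.1 ∈ cls r a
      · have hq2 : q.2 ∈ cls r a := mem_cls.2 ⟨h2, fun u => (h3 u).symm.trans ((mem_cls.1 hq).2 u)⟩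
        rw [merge_iff_right hq, merge_iff_right hq2]
      · have hq2 : q.2 ∉ cls r a := fun h =>
          hq (mem_cls.2 ⟨h1, fun u => (h3 u).trans ((mem_cls.1 h).2 u)⟩)
        rw [merge_iff hq, merge_iff hq2, h3]

theorem exists_tops_of_not_layered (hr : StrictOrd r) (h : ¬ Layered r) :
    ∃ a b, IsMaxFor r a ∧ IsMaxFor r b ∧ ¬ ∀ u, r u a ↔ r u b := by
  simp only [Layered, not_forall] at h
  obtain ⟨u, v, hv, hu, huv⟩ := h
  obtain ⟨w, hw, huw⟩ := (exists_top_above hr u).resolve_left hu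
  exact ⟨w, v, hw, hv, fun h => huv ((h u).1 huw)⟩

/-- An interior maximum makes the convex sequence constant from 0 to `p`. The merge at 0 is then
optimal, and layered by induction, so strictness at 1 would push stage 2 above `M`. -/
theorem layered_of_optimal {l M : ℕ} (hl : 2 ≤ l)
    (hM : ∀ r' : P → P → Prop, StrictOrd r' → cnt l r' ≤ M) (hM0 : 0 < M)
    (hr : StrictOrd r) (hcnt : cnt l r = M) : Layered r := by
  classical
  induction hk : Fintype.card (P × P) - (twins r).card using Nat.strong_induction_on
    generalizing r with
  | _ k ih =>
    by_contra hlay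
    obtain ⟨a, b, ha, hb, hab⟩ := exists_tops_of_not_layered hr hlay
    obtain ⟨rk, p, m, h⟩ := exists_isRanking ha hb hab
    have hpos := h.pos
    have key := convex_eq_max_left (G := fun i => (cnt l (stage r a b rk i) : ℤ)) (m := m) (M := M)
      (fun i hi => by exact_mod_cast h.convex_cnt l hi)
      (fun i => by exact_mod_cast hM _ (strictOrd_stage hr i)) h.lt
      (by rw [h.stage_self]; exact_mod_cast hcnt)
    have k0 : cnt l (stage r a b rk 0) = M := by exact_mod_cast key 0 (Nat.zero_le _)
    have k1 : cnt l (stage r a b rk 1) = M := by exact_mod_cast key 1 hpos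
    have k2 := hM _ (strictOrd_stage hr (a := a) (b := b) (rk := rk) 2)
    have k0' := k0
    rw [stage_zero] at k0'
    have hlt := card_twins_lt ha hb hab
    have hle := Finset.card_le_univ (twins (merge r a b))
    have hl' := ih _ (by omega) (strictOrd_merge hr a b) k0' rfl
    have := h.strict_convex_one hl hr hb hab hl' (by rwa [k0']) (by omega)
    omega

-- Any `l - 2` of the `i` elements of rank below `i`, joined to `x` and `y`, form a cherry over each
-- `u` below `a` and not below `b`. It exists at stage `i + 2` but not at `i + 1`, where `y` is
-- still a clone of `b`.
open Classical in
theorem IsRanking.convex_gain {l : ℕ} (hl : 2 ≤ l) {a b : P} {rk : P → ℕ} {p m : ℕ}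
    (h : IsRanking r a b rk p m) {i : ℕ} (hi : i + 1 < m) :
    2 * cnt l (stage r a b rk (i + 1)) +
      (univ.filter fun u => r u a ∧ ¬ r u b).card * i.choose (l - 2) ≤
      cnt l (stage r a b rk (i + 2)) + cnt l (stage r a b rk i) := by
  obtain ⟨x, hx, hxi⟩ := h.surj i (by omega)
  obtain ⟨y, hy, hyi⟩ := h.surj (i + 1) hi
  have hxy : x ≠ y := by rintro rfl; omega
  set W := (cls r a ∪ cls r b).filter fun t => rk t < i with hW
  have hWc : W.card = i := by
    have h1 : W.image rk = range i := by
      ext j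
      simp only [hW, mem_image, mem_range, mem_filter]
      constructor
      · rintro ⟨v, ⟨-, hv⟩, rfl⟩
        exact hv
      · intro hj
        obtain ⟨v, hv, hvj⟩ := h.surj j (by omega)
        exact ⟨v, ⟨hv, by omega⟩, hvj⟩
    rw [← card_range i, ← h1, card_image_of_injOn]
    intro v hv w hw e
    exact h.rk_injOn (mem_filter.1 hv).1 (mem_filter.1 hw).1 e
  have hxW : x ∉ W := fun h => by have := (mem_filter.1 h).2; omega
  have hyW : y ∉ W := fun h => by have := (mem_filter.1 h).2; omega
  set F := (powersetCard (l - 2) W).image fun Z => insert x (insert y Z) with hF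
  have hFc : F.card = i.choose (l - 2) := by
    rw [hF, card_image_of_injOn, card_powersetCard, hWc]
    intro Z hZ Z' hZ' e
    rw [mem_coe, mem_powersetCard] at hZ hZ'
    have aux : ∀ Z'' ⊆ W, Z'' = ((insert x (insert y Z'')).erase x).erase y := by
      intro Z'' hZ''
      rw [erase_insert, erase_insert]
      · exact fun h => hyW (hZ'' h)
      · simp only [mem_insert, not_or]
        exact ⟨hxy, fun h => hxW (hZ'' h)⟩
    rw [aux Z hZ.1, aux Z' hZ'.1]
    simp only at e
    rw [e]
  rw [← hFc, ← card_product]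
  refine le_trans (by simp) (h.convex_add l hx hy hxi hyi
    ((univ.filter fun u => r u a ∧ ¬ r u b) ×ˢ F) ∅ (fun q hq => ?_) (by simp))
  rw [mem_product, mem_filter, hF, mem_image] at hq
  obtain ⟨⟨-, hqa, hqb⟩, Z, hZ, hZq⟩ := hq
  rw [mem_powersetCard] at hZ
  have hSub : ∀ s ∈ q.2, s ∈ cls r a ∪ cls r b ∧ rk s < i + 2 := by
    intro s hs
    rw [← hZq, mem_insert, mem_insert] at hs
    rcases hs with rfl | rfl | hs
    · exact ⟨hx, by omega⟩
    · exact ⟨hy, by omega⟩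
    · have := mem_filter.1 (hZ.1 hs)
      exact ⟨this.1, by omega⟩
  refine ⟨?_, ?_, by simp [← hZq], by simp [← hZq]⟩
  · rw [mem_cherries]
    refine ⟨?_, fun s hs => ?_, fun s hs t _ => ?_⟩
    · rw [← hZq, card_insert_of_notMem, card_insert_of_notMem, hZ.2]
      · omega
      · exact fun h => hyW (hZ.1 h)
      · simp only [mem_insert, not_or]
        exact ⟨hxy, fun h => hxW (hZ.1 h)⟩
    · exact (stage_of_lt (hSub s hs).1 (hSub s hs).2).2 hqa
    · exact isMaxFor_stage (isMaxFor_of_mem_union (hSub s hs).1) t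
  · rw [mem_cherries]
    intro hq
    exact hqb ((stage_of_le hy (by omega)).1 (hq.2.1 y (by simp [← hZq])))

theorem two_le_choose {n k : ℕ} (hk : 0 < k) (hkn : k < n) : 2 ≤ n.choose k := by
  obtain ⟨k, rfl⟩ : ∃ k', k = k' + 1 := ⟨k - 1, by omega⟩
  obtain ⟨n, rfl⟩ : ∃ n', n = n' + 1 := ⟨n - 1, by omega⟩
  rw [Nat.choose_succ_succ']
  have h1 : 0 < n.choose k := Nat.choose_pos (by omega)
  have h2 : 0 < n.choose (k + 1) := Nat.choose_pos (by omega)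
  omega

/-- Moving one element from the class of `b` to that of `a`, when only `n` is gained below it. -/
theorem card_below_add_cnt_le {a b : P} {rk : P → ℕ} {p m : ℕ} (h : IsRanking r a b rk p m)
    (hr : StrictOrd r) (hb : IsMaxFor r b) (hab : ¬ ∀ u, r u a ↔ r u b)
    (hlay : Layered (merge r a b)) {n : P} (hna : r n a) (hnb : ¬ r n b)
    (huniq : ∀ u, r u a → ¬ r u b → u = n) :
    cnt 2 (stage r a b rk 1) + (below r b).card ≤ cnt 2 (stage r a b rk 0) := by
  classical
  have hpm := h.pos
  have hpm' := h.lt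
  obtain ⟨x, hx, hxi⟩ := h.surj 0 (by omega)
  have hxt := isMaxFor_of_mem_union hx
  have hn := (hlay.below_of_not_rel hb hab hna hnb).2
  have hba : ∀ u, r u b → r u a := fun u hu => hr.trans _ _ _ ((hn u).2 hu) hna
  have hnT : n ∉ cls r a ∪ cls r b := fun h => isMaxFor_of_mem_union h _ hna
  have hxn : x ≠ n := by rintro rfl; exact hnT hx
  have agree : ∀ u w, w ≠ x → (stage r a b rk 1 u w ↔ stage r a b rk 0 u w) := by
    intro u w hw
    by_cases hwT : w ∈ cls r a ∪ cls r b
    · have : rk w ≠ 0 := fun e => hw (h.rk_injOn hwT hx (e.trans hxi.symm))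
      rw [stage_of_le hwT (by omega), stage_of_le hwT (by omega)]
    · rw [stage_of_notMem hwT, stage_of_notMem hwT]
  have at1 : ∀ u, stage r a b rk 1 u x ↔ r u a := fun u => stage_of_lt hx (by omega)
  have at0 : ∀ u, stage r a b rk 0 u x ↔ r u b := fun u => stage_of_le hx (by omega)
  have atn : ∀ i u, stage r a b rk i u n ↔ r u n := fun i u => stage_of_notMem hnT
  -- At stage 1 nothing but `x` lies above `n`, so `n` is the bottom of no cherry with two top
  -- elements, and the relation gained by the move creates none.
  have hbelow : ∀ u w, stage r a b rk 1 u w → w ≠ x → ¬ (u = n) := by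
    rintro u w huw hwx rfl
    rw [agree _ _ hwx] at huw
    by_cases hwT : w ∈ cls r a ∪ cls r b
    · exact hnb ((stage_of_le hwT (Nat.zero_le _)).1 huw)
    rw [stage_of_notMem hwT] at huw
    have hwt : ¬ IsMaxFor r w := fun h => hwT (hlay.mem_union_of_isMaxFor hb hab h)
    obtain ⟨z, hz, hwz⟩ := (exists_top_above hr w).resolve_left hwt
    have hwb : ¬ r w b := fun h => hnb (hr.trans _ _ _ huw h)
    have hwa : r w a := by
      have hz' := hlay.mem_union_of_isMaxFor hb hab hz
      rw [mem_union, mem_cls, mem_cls] at hz'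
      rcases hz' with hz' | hz'
      · exact (hz'.2 w).1 hwz
      · exact absurd ((hz'.2 w).1 hwz) hwb
    rw [huniq w hwa hwb] at huw
    exact hr.irrefl _ huw
  -- At stage 0 `n` and `x` are incomparable with the same down-set; the resulting cherries
  -- disappear at stage 1, where `n` lies below `x`.
  have hinj : ((below r b).image fun β => (β, ({x, n} : Finset P))).card = (below r b).card :=
    card_image_of_injective _ fun β β' e => (Prod.mk.inj e).1
  rw [← hinj, cnt, cnt, ← card_union_of_disjoint]
  · refine Finset.card_le_card fun q hq => ?_
    rw [mem_union] at hq
    rcases hq with hq | hq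
    · rw [mem_cherries] at hq ⊢
      refine ⟨hq.1, fun s hs => ?_, fun s hs t ht hst => ?_⟩
      · by_cases hsx : s = x
        · subst hsx
          have h1 := (at1 _).1 (hq.2.1 s hs)
          rw [at0]
          by_contra h2
          obtain ⟨s', hs', hne⟩ := Finset.exists_mem_ne (s := q.2) (by omega) s
          exact hbelow _ _ (hq.2.1 s' hs') hne (huniq _ h1 h2)
        · exact (agree _ _ hsx).1 (hq.2.1 s hs)
      · by_cases htx : t = x
        · subst htx
          exact hq.2.2 s hs t ht ((at1 _).2 (hba _ ((at0 _).1 hst)))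
        · exact hq.2.2 s hs t ht ((agree _ _ htx).2 hst)
    · rw [mem_image] at hq
      obtain ⟨β, hβ, rfl⟩ := hq
      rw [mem_below] at hβ
      rw [mem_cherries]
      refine ⟨card_pair hxn, fun s hs => ?_, fun s hs t ht => ?_⟩
      · simp only [mem_insert, mem_singleton] at hs
        rcases hs with rfl | rfl
        · exact (at0 _).2 hβ
        · rw [atn, hn]; exact hβ
      · simp only [mem_insert, mem_singleton] at hs ht
        rcases hs with rfl | rfl
        · exact isMaxFor_stage hxt t
        · rcases ht with rfl | rfl
          · rw [at0]; exact hnb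
          · rw [atn]; exact hr.irrefl _
  · rw [Finset.disjoint_right]
    intro q hq hq'
    rw [mem_image] at hq
    obtain ⟨β, hβ, rfl⟩ := hq
    rw [mem_cherries] at hq'
    exact hq'.2.2 n (by simp) x (by simp) ((at1 _).2 hna)

theorem card_eq_five_of_merges_optimal {l M : ℕ} (hl : 2 ≤ l)
    (hM : ∀ r' : P → P → Prop, StrictOrd r' → cnt l r' ≤ M) (hr : StrictOrd r)
    (hcnt : cnt l r + 1 = M)
    (hno : ∀ r' : P → P → Prop, StrictOrd r' → cnt l r' = M → (tops r').card ≠ l)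
    {a b : P} (ha : IsMaxFor r a) (hb : IsMaxFor r b) (hab : ¬ ∀ u, r u a ↔ r u b)
    (h1 : cnt l (merge r a b) = M) (h2 : cnt l (merge r b a) = M)
    (hN : ∃ n, r n a ∧ ¬ r n b) : l = 2 ∧ Fintype.card P = 5 := by
  classical
  obtain ⟨n, hna, hnb⟩ := hN
  have s1 := strictOrd_merge hr a b
  have s2 := strictOrd_merge hr b a
  have lay1 := layered_of_optimal hl hM (by omega) s1 h1
  have lay2 := layered_of_optimal hl hM (by omega) s2 h2
  have hn := (lay1.below_of_not_rel hb hab hna hnb).2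
  have hba : ∀ u, r u b → r u a := fun u hu => hr.trans _ _ _ ((hn u).2 hu) hna
  have ha' : a ∉ cls r b := fun h => hab fun u => (mem_cls.1 h).2 u
  have hb' : b ∉ cls r a := fun h => hab fun u => ((mem_cls.1 h).2 u).symm
  have hbelow : ∀ z, z ∉ cls r a ∪ cls r b → r z a := by
    intro z hz
    have hzt : ¬ IsMaxFor r z := fun h => hz (lay1.mem_union_of_isMaxFor hb hab h)
    obtain ⟨w, hw, hzw⟩ := (exists_top_above hr z).resolve_left hzt
    have hw' := lay1.mem_union_of_isMaxFor hb hab hw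
    rw [mem_union, mem_cls, mem_cls] at hw'
    rcases hw' with hw' | hw'
    · exact (hw'.2 z).1 hzw
    · exact hba _ ((hw'.2 z).1 hzw)
  have htops : tops (merge r b a) = cls r a ∪ cls r b := by
    ext z
    rw [mem_tops]
    constructor
    · intro hz
      by_contra hz'
      exact hz a ((merge_iff ha').2 (hbelow z hz'))
    · exact fun hz => isMaxFor_merge (isMaxFor_of_mem_union hz)
  obtain ⟨rk, p, m, h⟩ := exists_isRanking ha hb hab
  -- In `merge r b a` the maximal elements are exactly the two classes; layeredness gives at least
  -- `l` of them, and `hno` excludes equality.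
  have hml : l < m := by
    have h3 := lay2.le_card_tops_of_optimal (l := l) (by omega) s2 (by rwa [h2]) (by omega) (isMaxFor_merge ha)
    have h4 := hno _ s2 h2
    rw [htops, h.card] at h3 h4
    omega
  have g0 : cnt l (stage r a b rk 0) = M := by rw [stage_zero, h1]
  have gm : cnt l (stage r a b rk m) = M := by rw [h.stage_last, h2]
  have gp : cnt l (stage r a b rk p) + 1 = M := by rw [h.stage_self, hcnt]
  set v := (univ.filter fun u => r u a ∧ ¬ r u b).card with hv
  have hv1 : 1 ≤ v := Finset.card_pos.2 ⟨n, by simp [hna, hnb]⟩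
  rcases hl.eq_or_lt with rfl | hl3
  · refine ⟨rfl, ?_⟩
    obtain ⟨rfl, hv', hg1⟩ := strictConvex_two_ended
      (G := fun i => (cnt 2 (stage r a b rk i) : ℤ)) (v := v) (M := M)
      (by exact_mod_cast hv1) (fun i hi => by
        have := h.convex_gain le_rfl hi
        rw [Nat.sub_self, Nat.choose_zero_right, mul_one] at this
        exact_mod_cast this)
      (fun i => by exact_mod_cast hM _ (strictOrd_stage hr i)) h.pos h.lt
      (by exact_mod_cast g0) (by omega) (by exact_mod_cast gm) hml
    have hvone : v = 1 := by exact_mod_cast hv'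
    obtain ⟨n', hn'⟩ := Finset.card_eq_one.1 hvone
    have huniq : ∀ u, r u a → ¬ r u b → u = n := by
      intro u hu hu'
      have e1 : u ∈ ({n'} : Finset P) := by rw [← hn']; simp [hu, hu']
      have e2 : n ∈ ({n'} : Finset P) := by rw [← hn']; simp [hna, hnb]
      rw [mem_singleton] at e1 e2
      rw [e1, e2]
    -- The drop from `G 0` to `G 1` is 1 and bounds the number of elements below `b`.
    have hd := card_below_add_cnt_le h hr hb hab lay1 hna hnb huniq
    obtain ⟨q, hq, hbq⟩ := exists_cherry_mem_of_optimal (l := 2) (by omega) s1 (by rwa [h1]) (by omega)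
      (isMaxFor_merge hb)
    have hβ := (merge_iff hb').1 ((mem_cherries.1 hq).2.1 b hbq)
    have hd' : 0 < (below r b).card := Finset.card_pos.2 ⟨_, mem_below.2 hβ⟩
    have hdone : (below r b).card = 1 := by omega
    have huniv : (univ : Finset P) = (cls r a ∪ cls r b) ∪
        (below r b ∪ univ.filter fun u => r u a ∧ ¬ r u b) := by
      ext z
      simp only [mem_univ, true_iff]
      rw [mem_union, mem_union (s := below r b), mem_below, mem_filter]
      by_cases hz : z ∈ cls r a ∪ cls r b
      · exact Or.inl hz
      · have := hbelow z hz
        by_cases hzb : r z b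
        · exact Or.inr (Or.inl hzb)
        · exact Or.inr (Or.inr ⟨mem_univ _, this, hzb⟩)
    rw [← card_univ, huniv, card_union_of_disjoint, h.card, card_union_of_disjoint, hdone, ← hv,
      hvone]
    · rw [Finset.disjoint_left]
      intro z hz hz'
      exact (mem_filter.1 hz').2.2 (mem_below.1 hz)
    · rw [Finset.disjoint_left]
      intro z hz hz'
      have hzt := isMaxFor_of_mem_union hz
      rw [mem_union, mem_below, mem_filter] at hz'
      rcases hz' with hz' | hz'
      · exact hzt _ hz'
      · exact hzt _ hz'.2.1
  · exfalso
    have hs1 := h.strict_convex_one hl hr hb hab lay1 (by rwa [h1]) (by omega)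
    have hs2 := h.convex_gain hl (i := m - 2) (by omega)
    have e1 : m - 2 + 1 = m - 1 := by omega
    have e2 : m - 2 + 2 = m := by omega
    rw [e1, e2, ← hv] at hs2
    have hc : 2 ≤ (m - 2).choose (l - 2) := two_le_choose (by omega) (by omega)
    have hvc : 2 ≤ v * (m - 2).choose (l - 2) := by nlinarith
    exact convex_two_ended (G := fun i => (cnt l (stage r a b rk i) : ℤ)) (m := m) (M := M)
      (fun i hi => by exact_mod_cast h.convex_cnt l hi) h.pos h.lt
      (by exact_mod_cast g0) (by omega) (by exact_mod_cast gm)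
      (by omega) (by omega) (by omega)

theorem exists_layered_or_of_near_optimal {l M : ℕ} (hl : 2 ≤ l)
    (hM : ∀ r' : P → P → Prop, StrictOrd r' → cnt l r' ≤ M) (hr : StrictOrd r)
    (hcnt : cnt l r + 1 = M) :
    (∃ r' : P → P → Prop, StrictOrd r' ∧
      ((cnt l r' + 1 = M ∧ Layered r') ∨ (cnt l r' = M ∧ (tops r').card = l))) ∨
      (l = 2 ∧ Fintype.card P = 5) := by
  classical
  by_contra! hcon
  obtain ⟨hcon, h5⟩ := hcon
  have hno : ∀ r' : P → P → Prop, StrictOrd r' → cnt l r' = M → (tops r').card ≠ l :=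
    fun r' hr' => (hcon r' hr').2
  induction hk : Fintype.card (P × P) - (twins r).card using Nat.strong_induction_on
    generalizing r with
  | _ k ih =>
    obtain ⟨a, b, ha, hb, hab⟩ := exists_tops_of_not_layered hr ((hcon r hr).1 hcnt)
    have hba : ¬ ∀ u, r u b ↔ r u a := fun h => hab fun u => (h u).symm
    -- A merge of value `M - 1` would be a counterexample with more twins.
    have hne : ∀ a b, IsMaxFor r a → IsMaxFor r b → (¬ ∀ u, r u a ↔ r u b) →
        cnt l (merge r a b) + 1 ≠ M := by
      intro a b ha hb hab he
      have hlt := card_twins_lt ha hb hab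
      have hle := Finset.card_le_univ (twins (merge r a b))
      exact ih _ (by omega) (strictOrd_merge hr a b) he rfl
    have main : ∀ a b, IsMaxFor r a → IsMaxFor r b → (¬ ∀ u, r u a ↔ r u b) →
        cnt l (merge r a b) = M → cnt l (merge r b a) = M := by
      intro a b ha hb hab he
      have hba : ¬ ∀ u, r u b ↔ r u a := fun h => hab fun u => (h u).symm
      obtain ⟨rk, p, m, h⟩ := exists_isRanking ha hb hab
      have hlay := layered_of_optimal hl hM (by omega) (strictOrd_merge hr a b) he
      have hs1 := h.strict_convex_one hl hr hb hab hlay (by rwa [he]) (by omega)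
      have := convex_left_end (G := fun i => (cnt l (stage r a b rk i) : ℤ)) (m := m) (M := M)
        (fun i hi => by exact_mod_cast h.convex_cnt l hi) h.pos h.lt
        (by rw [stage_zero, he]) (by rw [h.stage_self]; omega) (by omega)
      rw [h.stage_last] at this
      have := hne b a hb ha hba
      have := hM _ (strictOrd_merge hr b a)
      omega
    have hend : cnt l (merge r a b) = M ∨ cnt l (merge r b a) = M := by
      by_contra! hc
      obtain ⟨rk, p, m, h⟩ := exists_isRanking ha hb hab
      have e1 := hne a b ha hb hab
      have e2 := hne b a hb ha hba
      have e3 := hM _ (strictOrd_merge hr a b)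
      have e4 := hM _ (strictOrd_merge hr b a)
      have := convex_le_end (G := fun i => (cnt l (stage r a b rk i) : ℤ)) (m := m)
        (fun i hi => by exact_mod_cast h.convex_cnt l hi) h.pos h.lt
        (by rw [stage_zero, h.stage_self]; omega)
      rw [h.stage_last, h.stage_self] at this
      omega
    have hboth : cnt l (merge r a b) = M ∧ cnt l (merge r b a) = M :=
      hend.elim (fun h => ⟨h, main a b ha hb hab h⟩) (fun h => ⟨main b a hb ha hba h, h⟩)
    by_cases hN : ∃ n, r n a ∧ ¬ r n b
    · obtain ⟨e, e'⟩ := card_eq_five_of_merges_optimal hl hM hr hcnt hno ha hb hab hboth.1 hboth.2 hN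
      exact h5 e e'
    · push Not at hN
      have hN' : ∃ n, r n b ∧ ¬ r n a := by
        by_contra! hc
        exact hab fun u => ⟨hN u, hc u⟩
      obtain ⟨e, e'⟩ :=
        card_eq_five_of_merges_optimal hl hM hr hcnt hno hb ha hba hboth.2 hboth.1 hN'
      exact h5 e e'

end nearOptimal

/-! ### Translation between posets and strict orders -/

section posets

theorem strictOrd_lt (P : Type*) [PartialOrder P] : StrictOrd (fun a b : P => a < b) where
  irrefl := lt_irrefl
  trans _ _ _ := lt_trans

/-- The partial order with strict part `r`. -/
@[reducible] def StrictOrd.toPartialOrder {P : Type*} {r : P → P → Prop} (hr : StrictOrd r) :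
    PartialOrder P where
  le a b := a = b ∨ r a b
  lt := r
  le_refl _ := Or.inl rfl
  le_trans a b c := by
    rintro (rfl | h1) (rfl | h2)
    · exact Or.inl rfl
    · exact Or.inr h2
    · exact Or.inr h1
    · exact Or.inr (hr.trans _ _ _ h1 h2)
  le_antisymm a b := by
    rintro (rfl | h1) (h2 | h2)
    · rfl
    · rfl
    · exact h2.symm
    · exact absurd (hr.trans _ _ _ h1 h2) (hr.irrefl _)
  lt_iff_le_not_ge a b := by
    constructor
    · intro h
      refine ⟨Or.inr h, ?_⟩
      rintro (rfl | h')
      · exact hr.irrefl _ h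
      · exact hr.irrefl _ (hr.trans _ _ _ h h')
    · rintro ⟨rfl | h, h'⟩
      · exact absurd (Or.inl rfl) h'
      · exact h

theorem nonempty_orderIso_iff {P Q : Type*} [PartialOrder P] [PartialOrder Q] {S : Set P} :
    Nonempty (S ≃o Q) ↔ ∃ f : Q ↪o P, Set.range f = S := by
  constructor
  · rintro ⟨e⟩
    refine ⟨e.symm.toOrderEmbedding.trans (OrderEmbedding.subtype _), ?_⟩
    ext x
    constructor
    · rintro ⟨q, rfl⟩
      exact (e.symm q).2
    · intro hx
      exact ⟨e ⟨x, hx⟩, by simp⟩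
  · rintro ⟨f, rfl⟩
    exact ⟨f.orderIso.symm⟩

theorem AntichainPoset.not_lt {n : ℕ} (x y : AntichainPoset n) : ¬ x < y := by
  intro h
  obtain rfl : x = y := h.le
  exact lt_irrefl _ h

/-- The labels of the antichain. -/
def antichainEquivFin (n : ℕ) : AntichainPoset n ≃ Fin n where
  toFun x := x.val
  invFun i := ⟨i⟩

theorem exists_orderEmbedding_iff {l : ℕ} {P : Type*} [PartialOrder P] [Fintype P] {S : Set P} :
    (∃ f : QPoset l ↪o P, Set.range f = S) ↔
      ∃ q ∈ cherries l (fun a b : P => a < b), insert q.1 (q.2 : Set P) = S := by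
  classical
  constructor
  · rintro ⟨f, rfl⟩
    let bot : QPoset l := Sum.inlₗ ⟨0⟩
    let top : AntichainPoset l ↪ P :=
      ⟨fun i => f (Sum.inrₗ i), fun i j h => by simpa using h⟩
    have : Fintype (AntichainPoset l) := Fintype.ofEquiv _ (antichainEquivFin l).symm
    refine ⟨(f bot, univ.map top), ?_, ?_⟩
    · rw [mem_cherries]
      refine ⟨?_, ?_, ?_⟩
      · rw [card_map, card_univ, Fintype.card_congr (antichainEquivFin l), Fintype.card_fin]
      · intro s hs
        rw [mem_map] at hs
        obtain ⟨i, -, rfl⟩ := hs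
        exact f.lt_iff_lt.2 (Sum.Lex.inl_lt_inr _ _)
      · intro s hs t ht
        rw [mem_map] at hs ht
        obtain ⟨i, -, rfl⟩ := hs
        obtain ⟨j, -, rfl⟩ := ht
        intro h
        have h' : (Sum.inrₗ i : QPoset l) < Sum.inrₗ j := f.lt_iff_lt.1 h
        exact AntichainPoset.not_lt i j (Sum.Lex.inr_lt_inr_iff.1 h')
    · ext x
      simp only [coe_map, coe_univ, Set.image_univ, Set.mem_insert_iff, Set.mem_range]
      constructor
      · rintro (rfl | ⟨i, rfl⟩)
        · exact ⟨bot, rfl⟩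
        · exact ⟨Sum.inrₗ i, rfl⟩
      · rintro ⟨y, rfl⟩
        rcases y with ⟨⟨i⟩⟩ | i
        · left
          have : i = 0 := Subsingleton.elim _ _
          subst this
          rfl
        · exact Or.inr ⟨i, rfl⟩
  · rintro ⟨⟨b, T⟩, hq, rfl⟩
    rw [mem_cherries] at hq
    obtain ⟨hc, hb, hT⟩ := hq
    simp only at hc hb hT
    let e : AntichainPoset l ≃ T := (antichainEquivFin l).trans (T.equivFinOfCardEq hc).symm
    let g : QPoset l → P := fun y => Sum.elim (fun _ => b) (fun i => (e i : P)) (ofLex y)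
    have gl : ∀ i, g (Sum.inlₗ i) = b := fun _ => rfl
    have gr : ∀ i, g (Sum.inrₗ i) = e i := fun _ => rfl
    have hle : ∀ x y : QPoset l, g x ≤ g y ↔ x ≤ y := by
      intro x y
      rcases x with x | x <;> rcases y with y | y
      · have hxy : x = y := by
          rcases x with ⟨x⟩; rcases y with ⟨y⟩
          rw [Subsingleton.elim x y]
        subst hxy
        exact ⟨fun _ => le_rfl, fun _ => le_rfl⟩
      · exact ⟨fun _ => Sum.Lex.inl_le_inr _ _, fun _ => (hb _ (e y).2).le⟩
      · exact ⟨fun h => absurd (h.trans_lt (hb _ (e x).2)) (lt_irrefl _),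
          fun h => absurd h Sum.Lex.not_inr_le_inl⟩
      · constructor
        · intro h
          have h' : (e x : P) = e y := by
            by_contra hne
            exact hT _ (e x).2 _ (e y).2 (lt_of_le_of_ne h hne)
          have : x = y := e.injective (Subtype.ext h')
          subst this
          exact le_rfl
        · intro h
          have : x = y := Sum.Lex.inr_le_inr_iff.1 h
          subst this
          exact le_rfl
    refine ⟨OrderEmbedding.ofMapLEIff g hle, ?_⟩
    ext x
    simp only [OrderEmbedding.coe_ofMapLEIff, Set.mem_range, Set.mem_insert_iff, mem_coe]
    constructor
    · rintro ⟨y, rfl⟩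
      rcases y with y | y
      · exact Or.inl rfl
      · exact Or.inr (e y).2
    · rintro (rfl | hx)
      · exact ⟨Sum.inlₗ ⟨0⟩, rfl⟩
      · refine ⟨Sum.inrₗ (e.symm ⟨x, hx⟩), ?_⟩
        rw [gr]
        simp

theorem copies_QPoset_eq_cnt (l : ℕ) (P : Type*) [PartialOrder P] [Fintype P] :
    copies (QPoset l) P = cnt l (fun a b : P => a < b) := by
  have key : {S : Set P | Nonempty (S ≃o QPoset l)} =
      (fun q : P × Finset P => insert q.1 (q.2 : Set P)) '' (cherries l fun a b : P => a < b) := by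
    ext S
    rw [Set.mem_ofPred_eq, nonempty_orderIso_iff, exists_orderEmbedding_iff]
    rfl
  unfold copies
  rw [key, Set.InjOn.ncard_image, Set.ncard_coe_finset, cnt]
  rintro ⟨b, S⟩ hq ⟨b', S'⟩ hq' h
  rw [mem_coe, mem_cherries] at hq hq'
  simp only at hq hq' h
  have hb : b ∉ S := fun h => lt_irrefl _ (hq.2.1 b h)
  have hb' : b' ∉ S' := fun h => lt_irrefl _ (hq'.2.1 b' h)
  -- The bottom is determined by the set: two different bottoms would lie below each other.
  have hbb : b = b' := by
    by_contra hne
    have h1 : b ∈ insert b' (S' : Set P) := h ▸ Set.mem_insert _ _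
    have h2 : b' ∈ insert b (S : Set P) := h ▸ Set.mem_insert _ _
    have h1' := h1.resolve_left hne
    have h2' := h2.resolve_left (Ne.symm hne)
    exact lt_asymm (hq'.2.1 b h1') (hq.2.1 b' h2')
  subst hbb
  refine Prod.ext rfl (Finset.ext fun x => ?_)
  have hx := Set.ext_iff.1 h x
  simp only [Set.mem_insert_iff, mem_coe] at hx
  by_cases hxb : x = b
  · subst hxb
    exact ⟨fun h => absurd h hb, fun h => absurd h hb'⟩
  · simpa [hxb] using hx

theorem isMax_iff_isMaxFor {P : Type*} [PartialOrder P] {x : P} :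
    IsMax x ↔ IsMaxFor (fun a b : P => a < b) x :=
  isMax_iff_forall_not_lt

theorem isLOT_of_layered {P : Type*} [PartialOrder P] (h : Layered fun a b : P => a < b) :
    IsLOT P := by
  refine ⟨isCompl_compl.symm, fun x y => ?_⟩
  simp only [Set.mem_compl_iff, maxElements, Set.mem_ofPred_eq]
  constructor
  · intro hxy
    by_cases hx : IsMax x
    · obtain rfl : x = y := hx.eq_of_le hxy
      exact Or.inr (Or.inl ⟨hx, hx, hxy⟩)
    · by_cases hy : IsMax y
      · exact Or.inr (Or.inr ⟨hx, hy⟩)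
      · exact Or.inl ⟨hx, hy, hxy⟩
  · rintro (⟨-, -, h⟩ | ⟨-, -, h⟩ | ⟨hx, hy⟩)
    · exact h
    · exact h
    · exact (h x y (isMax_iff_isMaxFor.1 hy) (mt isMax_iff_isMaxFor.2 hx)).le

theorem ncard_maxElements {P : Type*} [PartialOrder P] [Fintype P] :
    (maxElements P).ncard = (tops fun a b : P => a < b).card := by
  rw [← Set.ncard_coe_finset]
  congr 1
  ext x
  rw [mem_coe, mem_tops]
  exact isMax_iff_isMaxFor

end posets

theorem mainTheorem9 (l : ℕ) (hl : 2 ≤ l) (P : Type u) [PartialOrder P] [Finite P]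
    (hP : (copies (QPoset l) P : ℤ) = (maxCopies (QPoset l) (Nat.card P) : ℤ) - 1) :
    ∃ (Q : Type u) (_ : PartialOrder Q), Finite Q ∧ Nat.card Q = Nat.card P ∧
      (((copies (QPoset l) Q : ℤ) = (maxCopies (QPoset l) (Nat.card P) : ℤ) - 1 ∧ IsLOT Q) ∨
        (IsOptimal (QPoset l) Q ∧ (maxElements Q).ncard = l) ∨
        (l = 2 ∧ Nat.card P = 5)) := by
  have := Fintype.ofFinite P
  have hM : ∀ r : P → P → Prop, StrictOrd r → cnt l r ≤ maxCopies (QPoset l) (Nat.card P) := by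
    intro r hr
    let _ := hr.toPartialOrder
    have h := copies_le_maxCopies (QPoset l) P
    rwa [copies_QPoset_eq_cnt l P] at h
  have hcnt : cnt l (fun a b : P => a < b) + 1 = maxCopies (QPoset l) (Nat.card P) := by
    rw [copies_QPoset_eq_cnt l P] at hP
    omega
  rcases exists_layered_or_of_near_optimal hl hM (strictOrd_lt P) hcnt with
    ⟨r, hr, h⟩ | ⟨rfl, h5⟩
  · refine ⟨P, hr.toPartialOrder, inferInstance, rfl, ?_⟩
    let _ := hr.toPartialOrder
    have hc : copies (QPoset l) P = cnt l r := copies_QPoset_eq_cnt l P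
    rcases h with ⟨h1, h2⟩ | ⟨h1, h2⟩
    · refine Or.inl ⟨?_, isLOT_of_layered h2⟩
      rw [hc]
      omega
    · exact Or.inr (Or.inl ⟨hc.trans h1, ncard_maxElements.trans h2⟩)
  · exact ⟨P, inferInstance, inferInstance, rfl,
      Or.inr (Or.inr ⟨rfl, by rw [Nat.card_eq_fintype_card, h5]⟩)⟩
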